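/- For $a\in\mathbb R$, $A\in\mathbb R^{4\times4}$ let $\mathfrak g(a,0,A)$ be the six-dimensional almost abelian Lie algebra with basis $f_1,\dots,f_6$ in which $\langle f_1,\dots,f_5\rangle$ is an abelian ideal, $[f_6,f_1]=a f_1$, and $\operatorname{ad}_{f_6}$ acts on $\langle f_2,\dots,f_5\rangle$ by the matrix $A$. Let $(a_0,A_0)$ be one of the following data. With $$D(x,b)=\begin{pmatrix}x&b\\-b&x\end{pmatrix},$$ either $a_0=1$ and $A_0=\operatorname{diag}(-\tfrac12,-\tfrac12,-\tfrac12,-\tfrac12)$ (the algebra $\mathfrak k_1^{-1/2,-1/2}$) or $A_0=\operatorname{diag}(-\tfrac12,-\tfrac12,0,0)$ ($\mathfrak k_{17}^{-1/2}$); or $a_0=p\neq0$ and $A_0$ is block diagonal with blocks $D(-\tfrac p2,0),\,D(0,1)$ ($\mathfrak k_8^{p,-p/2,0}$); $D(-\tfrac p2,0),\,D(-\tfrac p2,1)$ ($\mathfrak k_8^{p,-p/2,-p/2}$); $D(-\tfrac p2,1),\,D(0,s)$ ($\mathfrak k_{11}^{p,-p/2,0,s}$); $D(-\tfrac p2,1),\,D(-\tfrac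 p2,s)$ ($\mathfrak k_{11}^{p,-p/2,-p/2,s}$), where $0<|s|\le1$; or $D(-\tfrac p2,1),\,0$ ($\mathfrak k_{19}^{p,-p/2}$). Write $\mu_0$ for the bracket of $\mathfrak g(a_0,0,A_0)$ and consider $J_\pm f_1=f_6,\ J_\pm f_2=\pm f_3,\ J_\pm f_4=\pm f_5$, $J_\pm^2=-\mathrm{Id}$, $g_0=\sum_i f^i\otimes f^i$. Put $\omega(\cdot,\cdot)=g(J_+\cdot,\cdot)$. The pluriclosed flow of left-invariant metrics is $\dot\omega=-(\rho^B_\omega)^{1,1}$, where $\rho^B$ is the Bismut Ricci form, and the corresponding bracket flow is $\dot\mu=-\pi(P_\mu)\mu$, $P_\mu=\tfrac12\omega_0^{-1}(\rho^B_\mu)^{1,1}$, where $\omega_0(\cdot,\cdot)=g_0(J_+\cdot,\cdot)$ is fixed and $(\pi(P)\mu)(X,Y)=P\mu(X,Y)-\mu(PX,Y)-\mu(X,PY)$. Let $k=\tfrac12\operatorname{rk}(A_0+A_0^t)$ and $$c(t)=\bigl(1+a_0^2(\tfrac k2+1)t\bigr)^{-1/2}.$$ Then: 1. $(J_+,J_-,g_0)$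 is a split generalized Kähler structure on $\mathfrak g(a_0,0,A_0)$. 2. The bracket flow starting at $\mu_0$ exists for all $t\ge0$, is unique, and evolves purely by scaling: $\mu(t)$ is the bracket of $\mathfrak g(a(t),0,A(t))$ with $(a(t),A(t))=c(t)\,(a_0,A_0)$. 3. The pluriclosed flow $g(t)$ of $(J_+,g_0)$ among left-invariant Hermitian metrics exists for all $t\ge0$ and is unique, $(J_+,J_-,g(t))$ is a split generalized Kähler structure for all $t\ge0$, and $g(t)=c(t)^{-2}\varphi_t^*g_0$ for a smooth family of Lie algebra automorphisms $\varphi_t$ commuting with $J_+$ and $J_-$, $\varphi_0=\mathrm{Id}$. 4. Hence $(J_+,J_-,g_0)$ is an expanding soliton for the generalized Kähler flow: $g(t)=\sigma(t)\varphi_t^*g_0$ with $\varphi_t$ as above and $\sigma$ strictly increasing on $[0,\infty)$. -/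

import Mathlib

open scoped Matrix ContDiff

noncomputable section

namespace LieGK

/-! Left-invariant tensors on a simply connected Lie group of dimension `n` are identified with
tensors on its Lie algebra, whose underlying vector space is `ℝⁿ`. The bracket is a bilinear map
`μ`; metrics and complex structures are matrices with respect to the standard basis. -/

/-- The vector space underlying an `n`-dimensional Lie algebra. -/
abbrev Vec (n : ℕ) : Type := Fin n → ℝ

/-- Bilinear maps `ℝⁿ × ℝⁿ → ℝⁿ`. -/
abbrev Bracket (n : ℕ) : Type := Vec n →ₗ[ℝ] Vec n →ₗ[ℝ] Vec n

variable {n : ℕ}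

/-- The `i`-th standard basis vector. -/
def stdVec (i : Fin n) : Vec n := Pi.single i 1

/-- `μ` is a Lie bracket. -/
structure IsLieBracket (μ : Bracket n) : Prop where
  alt : ∀ X, μ X X = 0
  jacobi : ∀ X Y Z, μ X (μ Y Z) + μ Y (μ Z X) + μ Z (μ X Y) = 0

/-- The bilinear form with Gram matrix `g`. -/
def inner (g : Matrix (Fin n) (Fin n) ℝ) (X Y : Vec n) : ℝ := X ⬝ᵥ (g *ᵥ Y)

/-- The Nijenhuis tensor of `J`. -/
def nijenhuis (μ : Bracket n) (J : Matrix (Fin n) (Fin n) ℝ) (X Y : Vec n) : Vec n :=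
  μ (J *ᵥ X) (J *ᵥ Y) - J *ᵥ (μ (J *ᵥ X) Y) - J *ᵥ (μ X (J *ᵥ Y)) - μ X Y

/-- `(J, g)` is a Hermitian structure on the Lie algebra `(ℝⁿ, μ)`: `J` is an integrable complex
structure and `g` is a `J`-invariant inner product. -/
structure IsHermitianStructure (μ : Bracket n) (J g : Matrix (Fin n) (Fin n) ℝ) : Prop where
  sq : J * J = -1
  integrable : ∀ X Y, nijenhuis μ J X Y = 0
  posDef : g.PosDef
  compatible : ∀ X Y, inner g (J *ᵥ X) (J *ᵥ Y) = inner g X Y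

/-- The fundamental form `ω(X, Y) = g(JX, Y)`. -/
def fundForm (J g : Matrix (Fin n) (Fin n) ℝ) (X Y : Vec n) : ℝ := inner g (J *ᵥ X) Y

/-- The exterior derivative of a left-invariant `2`-form. -/
def d₂ (μ : Bracket n) (α : Vec n → Vec n → ℝ) (X Y Z : Vec n) : ℝ :=
  -α (μ X Y) Z - α (μ Y Z) X - α (μ Z X) Y

/-- The exterior derivative of a left-invariant `3`-form. -/
def d₃ (μ : Bracket n) (β : Vec n → Vec n → Vec n → ℝ) (X Y Z W : Vec n) : ℝ :=
  -β (μ X Y) Z W + β (μ X Z) Y W - β (μ X W) Y Z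
    - β (μ Y Z) X W + β (μ Y W) X Z - β (μ Z W) X Y

/-- The `3`-form `dᶜω = -J d J ω`, where `J` acts on a `p`-form by
`(Jα)(X₁, …, X_p) = (-1)ᵖ α(JX₁, …, JX_p)`. Thus `dᶜω(X, Y, Z) = dω(JX, JY, JZ)`. -/
def dcFund (μ : Bracket n) (J g : Matrix (Fin n) (Fin n) ℝ) (X Y Z : Vec n) : ℝ :=
  d₂ μ (fundForm J g) (J *ᵥ X) (J *ᵥ Y) (J *ᵥ Z)

/-- `(J, g)` is strong Kähler with torsion: it is Hermitian and `ddᶜω = 0`. -/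
structure IsSKT (μ : Bracket n) (J g : Matrix (Fin n) (Fin n) ℝ) : Prop where
  hermitian : IsHermitianStructure μ J g
  ddc : ∀ X Y Z W, d₃ μ (dcFund μ J g) X Y Z W = 0

/-- `(J₊, J₋, g)` is a split generalized Kähler structure on the Lie algebra `(ℝⁿ, μ)`. -/
structure IsSplitGK (μ : Bracket n) (Jp Jm g : Matrix (Fin n) (Fin n) ℝ) : Prop where
  lie : IsLieBracket μ
  skt_plus : IsSKT μ Jp g
  skt_minus : IsSKT μ Jm g
  dc_add : ∀ X Y Z, dcFund μ Jp g X Y Z + dcFund μ Jm g X Y Z = 0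
  split : Jp * Jm = Jm * Jp

/-- `g(∇_X Y, Z)` for the Levi-Civita connection `∇`, by the Koszul formula. -/
def leviCivitaLow (μ : Bracket n) (g : Matrix (Fin n) (Fin n) ℝ) (X Y Z : Vec n) : ℝ :=
  (inner g (μ X Y) Z - inner g (μ Y Z) X + inner g (μ Z X) Y) / 2

/-- The Bismut connection: `g(∇ᴮ_X Y, Z) = g(∇_X Y, Z) + ½ dᶜω(X, Y, Z)`. For a Hermitian structure
`(J, g)` it is the unique connection with `∇ᴮ g = 0`, `∇ᴮ J = 0` and totally skew torsion. -/
def bismut (μ : Bracket n) (J g : Matrix (Fin n) (Fin n) ℝ) (X Y : Vec n) : Vec n :=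
  g⁻¹ *ᵥ fun i => leviCivitaLow μ g X Y (stdVec i) + dcFund μ J g X Y (stdVec i) / 2

/-- The curvature `[∇ᴮ_X, ∇ᴮ_Y] Z - ∇ᴮ_[X,Y] Z` of the Bismut connection. -/
def bismutCurv (μ : Bracket n) (J g : Matrix (Fin n) (Fin n) ℝ) (X Y Z : Vec n) : Vec n :=
  bismut μ J g X (bismut μ J g Y Z) - bismut μ J g Y (bismut μ J g X Z)
    - bismut μ J g (μ X Y) Z

/-- The Bismut Ricci form `-½ ∑ₖ g(Rᴮ(X, Y) eₖ, J eₖ)`, the sum over a `g`-orthonormal frame being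
written as the contraction with `g⁻¹` in the standard basis. -/
def bismutRicci (μ : Bracket n) (J g : Matrix (Fin n) (Fin n) ℝ) (X Y : Vec n) : ℝ :=
  -(1 / 2) * ∑ i, ∑ j, g⁻¹ i j * inner g (bismutCurv μ J g X Y (stdVec i)) (J *ᵥ stdVec j)

/-- The `(1,1)`-part of the Bismut Ricci form. -/
def bismutRicci11 (μ : Bracket n) (J g : Matrix (Fin n) (Fin n) ℝ) (X Y : Vec n) : ℝ :=
  (bismutRicci μ J g X Y + bismutRicci μ J g (J *ᵥ X) (J *ᵥ Y)) / 2

/-- `g(t)`, `t ∈ I`, is a family of Hermitian metrics on `(ℝⁿ, μ, J)` which solves the pluriclosed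
flow `ω̇ = -(ρᴮ)^{1,1}`. -/
def IsPluriclosedFlow (μ : Bracket n) (J : Matrix (Fin n) (Fin n) ℝ)
    (g : ℝ → Matrix (Fin n) (Fin n) ℝ) (I : Set ℝ) : Prop :=
  ∀ t ∈ I, IsHermitianStructure μ J (g t) ∧
    ∀ X Y, HasDerivWithinAt (fun s => fundForm J (g s) X Y) (-bismutRicci11 μ J (g t) X Y) I t

/-- `(J₊, J₋, g(t))`, `t ∈ I`, is a solution of the generalized Kähler flow: `g(t)` solves the
pluriclosed flow of `J₊` through split generalized Kähler structures. -/
def IsGKFlow (μ : Bracket n) (Jp Jm : Matrix (Fin n) (Fin n) ℝ)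
    (g : ℝ → Matrix (Fin n) (Fin n) ℝ) (I : Set ℝ) : Prop :=
  IsPluriclosedFlow μ Jp g I ∧ ∀ t ∈ I, IsSplitGK μ Jp Jm (g t)

/-- `φ` is an automorphism of the Lie algebra `(ℝⁿ, μ)`. -/
def IsLieAutomorphism (μ : Bracket n) (φ : Matrix (Fin n) (Fin n) ℝ) : Prop :=
  IsUnit φ.det ∧ ∀ X Y, φ *ᵥ μ X Y = μ (φ *ᵥ X) (φ *ᵥ Y)

/-- `(J₊, J₋, g₀)` is a soliton with scaling factor `σ`: the generalized Kähler flow starting from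
it exists for all `t ≥ 0`, is unique, and is `g(t) = σ(t) φ_t^* g₀` for a smooth family `φ_t` of
Lie algebra automorphisms which preserve `J₊` and `J₋`, with `φ_0 = id`. (Such automorphisms are
the differentials of biholomorphic automorphisms of the simply connected Lie group.) -/
def IsGKSoliton (μ : Bracket n) (Jp Jm g₀ : Matrix (Fin n) (Fin n) ℝ) (σ : ℝ → ℝ) : Prop :=
  ∃ g : ℝ → Matrix (Fin n) (Fin n) ℝ,
    g 0 = g₀ ∧ IsGKFlow μ Jp Jm g (Set.Ici 0) ∧
    (∀ (T : ℝ) (g' : ℝ → Matrix (Fin n) (Fin n) ℝ),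
      IsPluriclosedFlow μ Jp g' (Set.Ico 0 T) → g' 0 = g₀ →
        ∀ t ∈ Set.Ico 0 T, g' t = g t) ∧
    ∃ φ : ℝ → Matrix (Fin n) (Fin n) ℝ,
      φ 0 = 1 ∧ (∀ i j, ContDiffOn ℝ ∞ (fun t => φ t i j) (Set.Ici 0)) ∧
      ∀ t, 0 ≤ t →
        IsLieAutomorphism μ (φ t) ∧ φ t * Jp = Jp * φ t ∧ φ t * Jm = Jm * φ t ∧
        0 < σ t ∧ ∀ X Y, inner (g t) X Y = σ t * inner g₀ (φ t *ᵥ X) (φ t *ᵥ Y)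

/-- An expanding soliton: the scaling factor of the metric is increasing. -/
def IsExpandingGKSoliton (μ : Bracket n) (Jp Jm g₀ : Matrix (Fin n) (Fin n) ℝ) : Prop :=
  ∃ σ : ℝ → ℝ, IsGKSoliton μ Jp Jm g₀ σ ∧ StrictMonoOn σ (Set.Ici 0)

/-- The matrix of a bilinear form. -/
def formMatrix (α : Vec n → Vec n → ℝ) : Matrix (Fin n) (Fin n) ℝ :=
  Matrix.of fun i j => α (stdVec i) (stdVec j)

/-- The endomorphism `P_μ = ½ ω₀⁻¹ (ρᴮ_μ)^{1,1}`, where a bilinear form `α` is viewed as the map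
`X ↦ α(X, ·)`; thus `ω₀(P_μ X, Y) = ½ (ρᴮ_μ)^{1,1}(X, Y)`. -/
def bracketP (J g₀ : Matrix (Fin n) (Fin n) ℝ) (μ : Bracket n) : Matrix (Fin n) (Fin n) ℝ :=
  (1 / 2 : ℝ) • (((formMatrix (fundForm J g₀))ᵀ)⁻¹ * (formMatrix (bismutRicci11 μ J g₀))ᵀ)

/-- The action `(π(P)μ)(X, Y) = Pμ(X, Y) - μ(PX, Y) - μ(X, PY)` of endomorphisms on brackets. -/
def piAct (P : Matrix (Fin n) (Fin n) ℝ) (μ : Bracket n) (X Y : Vec n) : Vec n :=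
  P *ᵥ μ X Y - μ (P *ᵥ X) Y - μ X (P *ᵥ Y)

/-- `μ(t)`, `t ∈ I`, solves the bracket flow `μ̇ = -π(P_μ)μ` associated with the pluriclosed flow
on `(ℝⁿ, J, g₀)`. -/
def IsBracketFlow (J g₀ : Matrix (Fin n) (Fin n) ℝ) (μ : ℝ → Bracket n) (I : Set ℝ) : Prop :=
  ∀ t ∈ I, ∀ X Y,
    HasDerivWithinAt (fun s => μ s X Y) (-piAct (bracketP J g₀ (μ t)) (μ t) X Y) I t

/-! ### The six-dimensional almost abelian Lie algebras -/

/-- The endomorphism `ad f₆` of `𝔤(a, v, A)`: on the span of `f₁, …, f₅` it has the block matrix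
with rows `(a, 0)` and `(v, A)`, and it kills `f₆`. -/
def adMatrix (a : ℝ) (v : Fin 4 → ℝ) (A : Matrix (Fin 4) (Fin 4) ℝ) :
    Matrix (Fin 6) (Fin 6) ℝ :=
  !![a, 0, 0, 0, 0, 0;
     v 0, A 0 0, A 0 1, A 0 2, A 0 3, 0;
     v 1, A 1 0, A 1 1, A 1 2, A 1 3, 0;
     v 2, A 2 0, A 2 1, A 2 2, A 2 3, 0;
     v 3, A 3 0, A 3 1, A 3 2, A 3 3, 0;
     0, 0, 0, 0, 0, 0]

/-- The almost abelian Lie algebra `𝔤(a, v, A)` on `ℝ⁶ = ⟨f₁, …, f₆⟩`: the span of `f₁, …, f₅` is an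
abelian ideal and `f₆` acts on it by `adMatrix a v A`. -/
def almostAbelian (a : ℝ) (v : Fin 4 → ℝ) (A : Matrix (Fin 4) (Fin 4) ℝ) : Bracket 6 :=
  LinearMap.mk₂ ℝ
    (fun X Y => X 5 • (adMatrix a v A *ᵥ Y) - Y 5 • (adMatrix a v A *ᵥ X))
    (by intro X X' Y; simp only [Matrix.mulVec_add, Pi.add_apply]; module)
    (by intro r X Y; simp only [Matrix.mulVec_smul, Pi.smul_apply, smul_eq_mul]; module)
    (by intro X Y Y'; simp only [Matrix.mulVec_add, Pi.add_apply]; module)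
    (by intro r X Y; simp only [Matrix.mulVec_smul, Pi.smul_apply, smul_eq_mul]; module)

/-- The data `(a, A)` (with `v = 0`) of the seven families of six-dimensional non-Kähler almost
abelian Lie algebras which admit split generalized Kähler structures. In terms of the dual basis,
`𝔤(a, 0, A)` has the structure equations `df¹ = a f¹⁶`, `df^{i+1} = ∑ⱼ A_{ij} f^{j+1} ∧ f⁶`
(`1 ≤ i, j ≤ 4`), `df⁶ = 0`. -/
inductive SplitGKData : ℝ → Matrix (Fin 4) (Fin 4) ℝ → Prop
  /-- `𝔨₁^{-1/2,-1/2}` -/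
  | k1 : SplitGKData 1
      !![-1/2, 0, 0, 0;
         0, -1/2, 0, 0;
         0, 0, -1/2, 0;
         0, 0, 0, -1/2]
  /-- `𝔨₈^{p,-p/2,0}` -/
  | k8_zero (p : ℝ) (hp : p ≠ 0) : SplitGKData p
      !![-p/2, 0, 0, 0;
         0, -p/2, 0, 0;
         0, 0, 0, 1;
         0, 0, -1, 0]
  /-- `𝔨₈^{p,-p/2,-p/2}` -/
  | k8_half (p : ℝ) (hp : p ≠ 0) : SplitGKData p
      !![-p/2, 0, 0, 0;
         0, -p/2, 0, 0;
         0, 0, -p/2, 1;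
         0, 0, -1, -p/2]
  /-- `𝔨₁₁^{p,-p/2,0,s}` -/
  | k11_zero (p s : ℝ) (hp : p ≠ 0) (hs : 0 < |s|) (hs' : |s| ≤ 1) : SplitGKData p
      !![-p/2, 1, 0, 0;
         -1, -p/2, 0, 0;
         0, 0, 0, s;
         0, 0, -s, 0]
  /-- `𝔨₁₁^{p,-p/2,-p/2,s}` -/
  | k11_half (p s : ℝ) (hp : p ≠ 0) (hs : 0 < |s|) (hs' : |s| ≤ 1) : SplitGKData p
      !![-p/2, 1, 0, 0;
         -1, -p/2, 0, 0;
         0, 0, -p/2, s;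
         0, 0, -s, -p/2]
  /-- `𝔨₁₇^{-1/2}` -/
  | k17 : SplitGKData 1
      !![-1/2, 0, 0, 0;
         0, -1/2, 0, 0;
         0, 0, 0, 0;
         0, 0, 0, 0]
  /-- `𝔨₁₉^{p,-p/2}` -/
  | k19 (p : ℝ) (hp : p ≠ 0) : SplitGKData p
      !![-p/2, 1, 0, 0;
         -1, -p/2, 0, 0;
         0, 0, 0, 0;
         0, 0, 0, 0]

/-- The complex structure `J₊ f₁ = f₆`, `J₊ f₂ = f₃`, `J₊ f₄ = f₅`. -/
def Jplus : Matrix (Fin 6) (Fin 6) ℝ :=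
  !![0, 0, 0, 0, 0, -1;
     0, 0, -1, 0, 0, 0;
     0, 1, 0, 0, 0, 0;
     0, 0, 0, 0, -1, 0;
     0, 0, 0, 1, 0, 0;
     1, 0, 0, 0, 0, 0]

/-- The complex structure `J₋ f₁ = f₆`, `J₋ f₂ = -f₃`, `J₋ f₄ = -f₅`. -/
def Jminus : Matrix (Fin 6) (Fin 6) ℝ :=
  !![0, 0, 0, 0, 0, -1;
     0, 0, 1, 0, 0, 0;
     0, -1, 0, 0, 0, 0;
     0, 0, 0, 0, 1, 0;
     0, 0, 0, -1, 0, 0;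
     1, 0, 0, 0, 0, 0]

/-- The metric `g₀ = ∑ᵢ fⁱ ⊗ fⁱ`. -/
def stdMetric : Matrix (Fin 6) (Fin 6) ℝ := 1

/-- The number `k` with `2k = rk(A + Aᵗ)`. -/
def halfRank (A : Matrix (Fin 4) (Fin 4) ℝ) : ℝ := ((A + Aᵀ).rank : ℝ) / 2

/-- The function `c(t) = (1 + a²(k/2 + 1)t)^{-1/2}`. -/
def scaling (a : ℝ) (A : Matrix (Fin 4) (Fin 4) ℝ) (t : ℝ) : ℝ :=
  1 / √(1 + a ^ 2 * (halfRank A / 2 + 1) * t)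

end LieGK

end

noncomputable section

namespace LieGK

/-! All seven families have the form `rotBlocks x b y c` with x, y ∈ {0, -a/2}, that is, x(a + 2x) =
y(a + 2y) = 0. This is exactly what the SKT equation needs, and it turns a²(k/2 + 1) into K = a² -
ax - ay, because each block with entry -a/2 adds a²/2.

The flow never leaves the metrics `stretchedMetric u`. For these the Bismut Ricci form is -K f¹∧f⁶,
already of type (1,1) and independent of u (`bismutRicci_stretchedMetric`). Since ω(f₁, f₆) = u, the
pluriclosed flow is u' = K, so u = 1 + Kt. Dilating ⟨f₂, …, f₅⟩ by u^{-1/2} is an automorphism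
commuting with J₊ and J₋, and it pulls g₀ back to u⁻¹ `stretchedMetric u`; this gives the soliton.

On the bracket side π(P_μ)μ = (K/2)μ, with K quadratic in μ. The ansatz μ = c μ₀ becomes c' =
-(K/2)c³, solved by c = (1 + Kt)^{-1/2}.

Uniqueness is ODE uniqueness: both right-hand sides are C¹ in the entries, being built from sums,
products and an inverse Gram matrix. -/

/-- The block diagonal matrix with blocks `D(x, b)` and `D(y, c)`. -/
def rotBlocks (x b y c : ℝ) : Matrix (Fin 4) (Fin 4) ℝ :=
  !![x, b, 0, 0;
     -b, x, 0, 0;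
     0, 0, y, c;
     0, 0, -c, y]

/-- The metric `u (f¹ ⊗ f¹ + f⁶ ⊗ f⁶) + ∑_{2 ≤ i ≤ 5} fⁱ ⊗ fⁱ`. -/
def stretchedMetric (u : ℝ) : Matrix (Fin 6) (Fin 6) ℝ := Matrix.diagonal ![u, 1, 1, 1, 1, u]

/-! ### Tensors of the metrics `stretchedMetric u` -/

theorem Jplus_mulVec (X : Vec 6) : Jplus *ᵥ X = ![-X 5, -X 2, X 1, -X 4, X 3, X 0] := by
  ext i
  fin_cases i <;> simp [Jplus, Matrix.mulVec, dotProduct, Fin.sum_univ_six]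

theorem Jminus_mulVec (X : Vec 6) : Jminus *ᵥ X = ![-X 5, X 2, -X 1, X 4, -X 3, X 0] := by
  ext i
  fin_cases i <;> simp [Jminus, Matrix.mulVec, dotProduct, Fin.sum_univ_six]

theorem inner_stretchedMetric (u : ℝ) (X Y : Vec 6) :
    inner (stretchedMetric u) X Y =
      u * (X 0 * Y 0 + X 5 * Y 5) + X 1 * Y 1 + X 2 * Y 2 + X 3 * Y 3 + X 4 * Y 4 := by
  simp [inner, stretchedMetric, Matrix.mulVec_diagonal, dotProduct, Fin.sum_univ_six]
  ring

theorem almostAbelian_rotBlocks (a x b y c : ℝ) (X Y : Vec 6) :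
    almostAbelian a 0 (rotBlocks x b y c) X Y =
      ![a * (X 5 * Y 0 - Y 5 * X 0),
        x * (X 5 * Y 1 - Y 5 * X 1) + b * (X 5 * Y 2 - Y 5 * X 2),
        x * (X 5 * Y 2 - Y 5 * X 2) - b * (X 5 * Y 1 - Y 5 * X 1),
        y * (X 5 * Y 3 - Y 5 * X 3) + c * (X 5 * Y 4 - Y 5 * X 4),
        y * (X 5 * Y 4 - Y 5 * X 4) - c * (X 5 * Y 3 - Y 5 * X 3), 0] := by
  ext i
  fin_cases i <;>
    simp [almostAbelian, adMatrix, rotBlocks, dotProduct, Fin.sum_univ_six] <;> ring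

/-- f¹∧f⁶ is closed, and the rotations b, c preserve the area forms of their planes, so only the
traces 2x, 2y survive in dω. Since J₊ exchanges f¹ and f⁶ up to sign, dᶜω is a combination of
f¹∧f²∧f³ and f¹∧f⁴∧f⁵, free of u. -/
theorem dcFund_Jplus (a x b y c u : ℝ) (X Y Z : Vec 6) :
    dcFund (almostAbelian a 0 (rotBlocks x b y c)) Jplus (stretchedMetric u) X Y Z =
      -2 * x * (X 0 * (Y 1 * Z 2 - Y 2 * Z 1) - X 1 * (Y 0 * Z 2 - Y 2 * Z 0)
        + X 2 * (Y 0 * Z 1 - Y 1 * Z 0))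
      - 2 * y * (X 0 * (Y 3 * Z 4 - Y 4 * Z 3) - X 3 * (Y 0 * Z 4 - Y 4 * Z 0)
        + X 4 * (Y 0 * Z 3 - Y 3 * Z 0)) := by
  simp only [dcFund, d₂, fundForm, inner_stretchedMetric, almostAbelian_rotBlocks, Jplus_mulVec,
    Matrix.cons_val]
  ring

/-- Passing from J₊ to J₋ reverses the orientation of both planes ⟨f₂, f₃⟩ and ⟨f₄, f₅⟩. -/
theorem dcFund_Jminus (a x b y c u : ℝ) (X Y Z : Vec 6) :
    dcFund (almostAbelian a 0 (rotBlocks x b y c)) Jminus (stretchedMetric u) X Y Z =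
      -dcFund (almostAbelian a 0 (rotBlocks x b y c)) Jplus (stretchedMetric u) X Y Z := by
  rw [dcFund_Jplus]
  simp only [dcFund, d₂, fundForm, inner_stretchedMetric, almostAbelian_rotBlocks, Jminus_mulVec,
    Matrix.cons_val]
  ring

theorem isLieBracket_almostAbelian (a x b y c : ℝ) :
    IsLieBracket (almostAbelian a 0 (rotBlocks x b y c)) where
  alt X := by simp [almostAbelian]
  jacobi X Y Z := by
    ext i
    fin_cases i <;> simp [almostAbelian_rotBlocks] <;> ring

theorem stretchedMetric_posDef {u : ℝ} (hu : 0 < u) : (stretchedMetric u).PosDef := by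
  refine Matrix.PosDef.diagonal fun i => ?_
  fin_cases i <;> simp [hu]

theorem isHermitianStructure_Jplus (a x b y c : ℝ) {u : ℝ} (hu : 0 < u) :
    IsHermitianStructure (almostAbelian a 0 (rotBlocks x b y c)) Jplus (stretchedMetric u) where
  sq := by
    ext i j
    fin_cases i <;> fin_cases j <;> simp [Jplus, Matrix.mul_apply, Fin.sum_univ_six]
  integrable X Y := by
    ext i
    fin_cases i <;> simp [nijenhuis, almostAbelian_rotBlocks, Jplus_mulVec] <;> ring
  posDef := stretchedMetric_posDef hu
  compatible X Y := by
    simp only [inner_stretchedMetric, Jplus_mulVec, Matrix.cons_val]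
    ring

theorem isHermitianStructure_Jminus (a x b y c : ℝ) {u : ℝ} (hu : 0 < u) :
    IsHermitianStructure (almostAbelian a 0 (rotBlocks x b y c)) Jminus (stretchedMetric u) where
  sq := by
    ext i j
    fin_cases i <;> fin_cases j <;> simp [Jminus, Matrix.mul_apply, Fin.sum_univ_six]
  integrable X Y := by
    ext i
    fin_cases i <;> simp [nijenhuis, almostAbelian_rotBlocks, Jminus_mulVec] <;> ring
  posDef := stretchedMetric_posDef hu
  compatible X Y := by
    simp only [inner_stretchedMetric, Jminus_mulVec, Matrix.cons_val]
    ring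

/-- The component of `X ∧ Y ∧ Z ∧ W` along `f₁ ∧ f_i ∧ f_j ∧ f₆`. -/
def minor (i j : Fin 6) (X Y Z W : Vec 6) : ℝ :=
  (X 0 * Y i - X i * Y 0) * (Z j * W 5 - Z 5 * W j)
    - (X 0 * Y j - X j * Y 0) * (Z i * W 5 - Z 5 * W i)
    + (X 0 * Y 5 - X 5 * Y 0) * (Z i * W j - Z j * W i)
    + (X i * Y j - X j * Y i) * (Z 0 * W 5 - Z 5 * W 0)
    - (X i * Y 5 - X 5 * Y i) * (Z 0 * W j - Z j * W 0)
    + (X j * Y 5 - X 5 * Y j) * (Z 0 * W i - Z i * W 0)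

/-- The factors a + 2x and a + 2y are the traces of ad f₆ on ⟨f₁, f₂, f₃⟩ and ⟨f₁, f₄, f₅⟩. -/
theorem d₃_dcFund_Jplus (a x b y c u : ℝ) (X Y Z W : Vec 6) :
    d₃ (almostAbelian a 0 (rotBlocks x b y c))
      (dcFund (almostAbelian a 0 (rotBlocks x b y c)) Jplus (stretchedMetric u)) X Y Z W =
      -2 * (x * (a + 2 * x) * minor 1 2 X Y Z W + y * (a + 2 * y) * minor 3 4 X Y Z W) := by
  simp only [d₃, dcFund_Jplus, almostAbelian_rotBlocks, Matrix.cons_val, minor]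
  ring

theorem isSplitGK_stretchedMetric {a x b y c u : ℝ} (hx : x * (a + 2 * x) = 0)
    (hy : y * (a + 2 * y) = 0) (hu : 0 < u) :
    IsSplitGK (almostAbelian a 0 (rotBlocks x b y c)) Jplus Jminus (stretchedMetric u) where
  lie := isLieBracket_almostAbelian a x b y c
  skt_plus := ⟨isHermitianStructure_Jplus a x b y c hu, fun X Y Z W => by
    rw [d₃_dcFund_Jplus, hx, hy]
    ring⟩
  skt_minus := ⟨isHermitianStructure_Jminus a x b y c hu, fun X Y Z W => by
    have h := d₃_dcFund_Jplus a x b y c u X Y Z W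
    rw [hx, hy] at h
    simp only [d₃, dcFund_Jminus] at h ⊢
    linarith⟩
  dc_add X Y Z := by rw [dcFund_Jminus]; ring
  split := by
    ext i j
    fin_cases i <;> fin_cases j <;> simp [Jplus, Jminus, Matrix.mul_apply, Fin.sum_univ_six]

theorem inv_stretchedMetric {u : ℝ} (hu : u ≠ 0) :
    (stretchedMetric u)⁻¹ = Matrix.diagonal ![u⁻¹, 1, 1, 1, 1, u⁻¹] := by
  refine Matrix.inv_eq_right_inv ?_
  rw [stretchedMetric, Matrix.diagonal_mul_diagonal, ← Matrix.diagonal_one]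
  congr 1
  ext i
  fin_cases i <;> simp [hu]

theorem bismut_stretchedMetric (a x b y c : ℝ) {u : ℝ} (hu : u ≠ 0) (X Y : Vec 6) :
    bismut (almostAbelian a 0 (rotBlocks x b y c)) Jplus (stretchedMetric u) X Y =
      ![-a * X 0 * Y 5 + x * u⁻¹ * (X 2 * Y 1 - X 1 * Y 2) + y * u⁻¹ * (X 4 * Y 3 - X 3 * Y 4),
        x * (X 0 * Y 2 - X 1 * Y 5 - X 2 * Y 0) + b * X 5 * Y 2,
        x * (-X 0 * Y 1 + X 1 * Y 0 - X 2 * Y 5) - b * X 5 * Y 1,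
        y * (X 0 * Y 4 - X 3 * Y 5 - X 4 * Y 0) + c * X 5 * Y 4,
        y * (-X 0 * Y 3 + X 3 * Y 0 - X 4 * Y 5) - c * X 5 * Y 3,
        a * X 0 * Y 0 + x * u⁻¹ * (X 1 * Y 1 + X 2 * Y 2)
          + y * u⁻¹ * (X 3 * Y 3 + X 4 * Y 4)] := by
  ext i
  simp only [bismut, inv_stretchedMetric hu, Matrix.mulVec_diagonal, leviCivitaLow, dcFund_Jplus,
    inner_stretchedMetric, almostAbelian_rotBlocks, stdVec]
  fin_cases i <;> simp <;> field_simp <;> ring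

/-- Conceptually, ∇ᴮ commutes with J, so commutators drop out of the trace against J and only ∇ᴮ
along [X, Y] counts. That trace sees only the f₁-component of [X, Y], where ∇ᴮ involves neither u
nor b, c; it contributes a - x - y. -/
theorem bismutRicci_stretchedMetric (a x b y c : ℝ) {u : ℝ} (hu : u ≠ 0) (X Y : Vec 6) :
    bismutRicci (almostAbelian a 0 (rotBlocks x b y c)) Jplus (stretchedMetric u) X Y =
      -(a ^ 2 - a * x - a * y) * (X 0 * Y 5 - X 5 * Y 0) := by
  simp only [bismutRicci, inv_stretchedMetric hu, Matrix.diagonal_apply, ite_mul, zero_mul,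
    Finset.sum_ite_eq, Finset.mem_univ, if_true, Fin.sum_univ_six, bismutCurv,
    bismut_stretchedMetric _ _ _ _ _ hu, inner_stretchedMetric, almostAbelian_rotBlocks,
    Jplus_mulVec, stdVec, Matrix.cons_val, Pi.sub_apply, Pi.single_apply]
  simp
  field_simp
  ring

theorem bismutRicci11_stretchedMetric (a x b y c : ℝ) {u : ℝ} (hu : u ≠ 0) (X Y : Vec 6) :
    bismutRicci11 (almostAbelian a 0 (rotBlocks x b y c)) Jplus (stretchedMetric u) X Y =
      -(a ^ 2 - a * x - a * y) * (X 0 * Y 5 - X 5 * Y 0) := by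
  simp only [bismutRicci11, bismutRicci_stretchedMetric _ _ _ _ _ hu, Jplus_mulVec,
    Matrix.cons_val]
  ring


/-! ### ODE uniqueness on half-open intervals -/

section Uniqueness

open Set Filter Topology

/-- Solutions on `[0, T)` of an autonomous ODE whose right-hand side is `C¹` near one of them are
determined by their initial value. -/
theorem eqOn_Ico_of_contDiffAt {E : Type*} [NormedAddCommGroup E] [NormedSpace ℝ E]
    {v : E → E} {f g : ℝ → E} {T : ℝ}
    (hv : ∀ t ∈ Ico 0 T, ContDiffAt ℝ 1 v (g t))
    (hf : ∀ t ∈ Ico 0 T, HasDerivWithinAt f (v (f t)) (Ico 0 T) t)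
    (hg : ∀ t ∈ Ico 0 T, HasDerivWithinAt g (v (g t)) (Ico 0 T) t)
    (h0 : f 0 = g 0) : EqOn f g (Ico 0 T) := by
  intro τ hτ
  have hsub : Icc 0 τ ⊆ Ico 0 T := fun t ht => ⟨ht.1, ht.2.trans_lt hτ.2⟩
  have hfc : ContinuousOn f (Icc 0 τ) := fun t ht =>
    ((hf t (hsub ht)).mono hsub).continuousWithinAt
  have hgc : ContinuousOn g (Icc 0 τ) := fun t ht =>
    ((hg t (hsub ht)).mono hsub).continuousWithinAt
  -- Makes derivatives within [0, T) into right derivatives, also at 0.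
  have hIci : ∀ t ∈ Ico 0 T, Ico 0 T ∈ 𝓝[≥] t := fun t ht =>
    mem_of_superset (Ico_mem_nhdsGE ht.2) (Ico_subset_Ico_left ht.1)
  have hclosed : IsClosed ({t | f t = g t} ∩ Icc 0 τ) := by
    have h := (hfc.sub hgc).preimage_isClosed_of_isClosed isClosed_Icc (isClosed_singleton (x := 0))
    convert h using 1
    ext t
    simp [sub_eq_zero, and_comm]
  -- Continuous induction: the agreement set is closed and contains 0, so it suffices to extend
  -- agreement slightly to the right of each of its points.
  refine hclosed.Icc_subset_of_forall_mem_nhdsWithin h0 (fun t ht => ?_) (right_mem_Icc.2 hτ.1)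
  have htT : t ∈ Ico 0 T := hsub (Ico_subset_Icc_self ht.2)
  -- Near the common value the field is Lipschitz on U, and right continuity keeps both curves in U
  -- for a short time.
  obtain ⟨K, U, hU, hK⟩ := (hv t htT).exists_lipschitzOnWith
  have hfU : ∀ᶠ s in 𝓝[≥] t, f s ∈ U :=
    ((hf t htT).mono_of_mem_nhdsWithin (hIci t htT)).continuousWithinAt
      (by rw [show f t = g t from ht.1]; exact hU)
  have hgU : ∀ᶠ s in 𝓝[≥] t, g s ∈ U :=
    ((hg t htT).mono_of_mem_nhdsWithin (hIci t htT)).continuousWithinAt hU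
  obtain ⟨r, hr, hrU⟩ := mem_nhdsGE_iff_exists_Icc_subset.1
    ((hfU.and hgU).and (Ico_mem_nhdsGE ht.2.2))
  have hrτ : Icc t r ⊆ Icc 0 τ := fun s hs => ⟨ht.2.1.trans hs.1, (hrU hs).2.2.le⟩
  have heq : EqOn f g (Icc t r) :=
    ODE_solution_unique_of_mem_Icc_right (v := fun _ => v) (s := fun _ => U) (fun _ _ => hK)
      (hfc.mono hrτ)
      (fun s hs => have hs' := hsub (hrτ (Ico_subset_Icc_self hs))
        (hf s hs').mono_of_mem_nhdsWithin (hIci s hs'))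
      (fun s hs => (hrU (Ico_subset_Icc_self hs)).1.1)
      (hgc.mono hrτ)
      (fun s hs => have hs' := hsub (hrτ (Ico_subset_Icc_self hs))
        (hg s hs').mono_of_mem_nhdsWithin (hIci s hs'))
      (fun s hs => (hrU (Ico_subset_Icc_self hs)).1.2)
      ht.1
  exact mem_of_superset (Ioc_mem_nhdsGT hr) fun s hs => heq (Ioc_subset_Icc_self hs)

end Uniqueness

/-! ### Smooth dependence of the flow equations on metric and bracket -/

section Smoothness

variable {n : ℕ} {E : Type*} [NormedAddCommGroup E] [NormedSpace ℝ E] {k : WithTop ℕ∞} {p : E}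
  {μ : E → Bracket n} {J : Matrix (Fin n) (Fin n) ℝ} {g : E → Matrix (Fin n) (Fin n) ℝ}
  {X Y Z : E → Vec n}

theorem sum_smul_stdVec (X : Vec n) : ∑ i, X i • stdVec i = X := by
  ext j
  simp [stdVec, Finset.sum_apply, Pi.single_apply]

theorem contDiffAt_mulVec {M : E → Matrix (Fin n) (Fin n) ℝ}
    (hM : ∀ i j, ContDiffAt ℝ k (fun s => M s i j) p) (hX : ContDiffAt ℝ k X p) :
    ContDiffAt ℝ k (fun s => M s *ᵥ X s) p := by
  rw [contDiffAt_pi] at hX ⊢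
  simp only [Matrix.mulVec, dotProduct]
  exact fun i => ContDiffAt.sum fun j _ => (hM i j).mul (hX j)

theorem contDiffAt_const_mulVec (M : Matrix (Fin n) (Fin n) ℝ) (hX : ContDiffAt ℝ k X p) :
    ContDiffAt ℝ k (fun s => M *ᵥ X s) p :=
  contDiffAt_mulVec (fun _ _ => contDiffAt_const) hX

theorem contDiffAt_inner (hg : ∀ i j, ContDiffAt ℝ k (fun s => g s i j) p)
    (hX : ContDiffAt ℝ k X p) (hY : ContDiffAt ℝ k Y p) :
    ContDiffAt ℝ k (fun s => inner (g s) (X s) (Y s)) p := by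
  have hgY := contDiffAt_pi.1 (contDiffAt_mulVec hg hY)
  rw [contDiffAt_pi] at hX
  simp only [inner, dotProduct]
  exact ContDiffAt.sum fun i _ => (hX i).mul (hgY i)

theorem contDiffAt_det (hg : ∀ i j, ContDiffAt ℝ k (fun s => g s i j) p) :
    ContDiffAt ℝ k (fun s => (g s).det) p := by
  simp only [Matrix.det_apply]
  exact ContDiffAt.sum fun σ _ => (contDiffAt_prod fun i _ => hg (σ i) i).const_smul _

theorem contDiffAt_matrix_inv (hg : ∀ i j, ContDiffAt ℝ k (fun s => g s i j) p)
    (hdet : (g p).det ≠ 0) (i j : Fin n) : ContDiffAt ℝ k (fun s => (g s)⁻¹ i j) p := by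
  simp only [Matrix.inv_def, Ring.inverse_eq_inv', Matrix.smul_apply, smul_eq_mul,
    Matrix.adjugate_apply]
  -- Cramer's rule: an adjugate entry is the determinant of the matrix with one row made constant.
  refine ((contDiffAt_det hg).inv hdet).mul (contDiffAt_det fun a b => ?_)
  by_cases h : a = j
  · subst h
    simpa using contDiffAt_const
  · simpa [Matrix.updateRow_ne h] using hg a b

theorem contDiffAt_bracket (hμ : ∀ X Y, ContDiffAt ℝ k (fun s => μ s X Y) p)
    (hX : ContDiffAt ℝ k X p) (hY : ContDiffAt ℝ k Y p) :
    ContDiffAt ℝ k (fun s => μ s (X s) (Y s)) p := by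
  have h : ∀ s, μ s (X s) (Y s) = ∑ i, ∑ j, X s i • Y s j • μ s (stdVec i) (stdVec j) := by
    intro s
    conv_lhs => rw [← sum_smul_stdVec (X s), ← sum_smul_stdVec (Y s)]
    simp only [map_sum, map_smul, LinearMap.sum_apply, LinearMap.smul_apply, Finset.smul_sum]
    rw [Finset.sum_comm]
    exact Finset.sum_congr rfl fun i _ => Finset.sum_congr rfl fun j _ => smul_comm _ _ _
  simp only [h]
  rw [contDiffAt_pi] at hX hY
  exact ContDiffAt.sum fun i _ => ContDiffAt.sum fun j _ => (hX i).smul ((hY j).smul (hμ _ _))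

theorem contDiffAt_fundForm (hg : ∀ i j, ContDiffAt ℝ k (fun s => g s i j) p)
    (hX : ContDiffAt ℝ k X p) (hY : ContDiffAt ℝ k Y p) :
    ContDiffAt ℝ k (fun s => fundForm J (g s) (X s) (Y s)) p :=
  contDiffAt_inner hg (contDiffAt_const_mulVec J hX) hY

theorem contDiffAt_dcFund (hμ : ∀ X Y, ContDiffAt ℝ k (fun s => μ s X Y) p)
    (hg : ∀ i j, ContDiffAt ℝ k (fun s => g s i j) p)
    (hX : ContDiffAt ℝ k X p) (hY : ContDiffAt ℝ k Y p) (hZ : ContDiffAt ℝ k Z p) :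
    ContDiffAt ℝ k (fun s => dcFund (μ s) J (g s) (X s) (Y s) (Z s)) p := by
  have hJX := contDiffAt_const_mulVec J hX
  have hJY := contDiffAt_const_mulVec J hY
  have hJZ := contDiffAt_const_mulVec J hZ
  exact ((contDiffAt_fundForm hg (contDiffAt_bracket hμ hJX hJY) hJZ).neg.sub
    (contDiffAt_fundForm hg (contDiffAt_bracket hμ hJY hJZ) hJX)).sub
    (contDiffAt_fundForm hg (contDiffAt_bracket hμ hJZ hJX) hJY)

theorem contDiffAt_leviCivitaLow (hμ : ∀ X Y, ContDiffAt ℝ k (fun s => μ s X Y) p)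
    (hg : ∀ i j, ContDiffAt ℝ k (fun s => g s i j) p)
    (hX : ContDiffAt ℝ k X p) (hY : ContDiffAt ℝ k Y p) (hZ : ContDiffAt ℝ k Z p) :
    ContDiffAt ℝ k (fun s => leviCivitaLow (μ s) (g s) (X s) (Y s) (Z s)) p :=
  (((contDiffAt_inner hg (contDiffAt_bracket hμ hX hY) hZ).sub
    (contDiffAt_inner hg (contDiffAt_bracket hμ hY hZ) hX)).add
    (contDiffAt_inner hg (contDiffAt_bracket hμ hZ hX) hY)).div_const 2

theorem contDiffAt_bismut (hμ : ∀ X Y, ContDiffAt ℝ k (fun s => μ s X Y) p)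
    (hg : ∀ i j, ContDiffAt ℝ k (fun s => g s i j) p) (hdet : (g p).det ≠ 0)
    (hX : ContDiffAt ℝ k X p) (hY : ContDiffAt ℝ k Y p) :
    ContDiffAt ℝ k (fun s => bismut (μ s) J (g s) (X s) (Y s)) p :=
  contDiffAt_mulVec (contDiffAt_matrix_inv hg hdet) (contDiffAt_pi.2 fun _ =>
    (contDiffAt_leviCivitaLow hμ hg hX hY contDiffAt_const).add
      ((contDiffAt_dcFund hμ hg hX hY contDiffAt_const).div_const 2))

theorem contDiffAt_bismutCurv (hμ : ∀ X Y, ContDiffAt ℝ k (fun s => μ s X Y) p)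
    (hg : ∀ i j, ContDiffAt ℝ k (fun s => g s i j) p) (hdet : (g p).det ≠ 0)
    (hX : ContDiffAt ℝ k X p) (hY : ContDiffAt ℝ k Y p) (hZ : ContDiffAt ℝ k Z p) :
    ContDiffAt ℝ k (fun s => bismutCurv (μ s) J (g s) (X s) (Y s) (Z s)) p :=
  ((contDiffAt_bismut hμ hg hdet hX (contDiffAt_bismut hμ hg hdet hY hZ)).sub
    (contDiffAt_bismut hμ hg hdet hY (contDiffAt_bismut hμ hg hdet hX hZ))).sub
    (contDiffAt_bismut hμ hg hdet (contDiffAt_bracket hμ hX hY) hZ)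

theorem contDiffAt_bismutRicci (hμ : ∀ X Y, ContDiffAt ℝ k (fun s => μ s X Y) p)
    (hg : ∀ i j, ContDiffAt ℝ k (fun s => g s i j) p) (hdet : (g p).det ≠ 0) (X Y : Vec n) :
    ContDiffAt ℝ k (fun s => bismutRicci (μ s) J (g s) X Y) p :=
  contDiffAt_const.mul (ContDiffAt.sum fun i _ => ContDiffAt.sum fun j _ =>
    (contDiffAt_matrix_inv hg hdet i j).mul (contDiffAt_inner hg
      (contDiffAt_bismutCurv hμ hg hdet contDiffAt_const contDiffAt_const contDiffAt_const)
      contDiffAt_const))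

theorem contDiffAt_bismutRicci11 (hμ : ∀ X Y, ContDiffAt ℝ k (fun s => μ s X Y) p)
    (hg : ∀ i j, ContDiffAt ℝ k (fun s => g s i j) p) (hdet : (g p).det ≠ 0) (X Y : Vec n) :
    ContDiffAt ℝ k (fun s => bismutRicci11 (μ s) J (g s) X Y) p :=
  ((contDiffAt_bismutRicci hμ hg hdet X Y).add (contDiffAt_bismutRicci hμ hg hdet _ _)).div_const 2

theorem contDiffAt_bracketP {g₀ : Matrix (Fin n) (Fin n) ℝ}
    (hμ : ∀ X Y, ContDiffAt ℝ k (fun s => μ s X Y) p) (hdet : g₀.det ≠ 0) (i j : Fin n) :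
    ContDiffAt ℝ k (fun s => bracketP J g₀ (μ s) i j) p := by
  simp only [bracketP, Matrix.smul_apply, smul_eq_mul, Matrix.mul_apply,
    Matrix.transpose_apply, formMatrix, Matrix.of_apply]
  refine contDiffAt_const.mul (ContDiffAt.sum fun l _ => ContDiffAt.mul contDiffAt_const ?_)
  exact contDiffAt_bismutRicci11 (g := fun _ => g₀) hμ (fun _ _ => contDiffAt_const) hdet _ _

theorem contDiffAt_piAct {P : E → Matrix (Fin n) (Fin n) ℝ}
    (hP : ∀ i j, ContDiffAt ℝ k (fun s => P s i j) p)
    (hμ : ∀ X Y, ContDiffAt ℝ k (fun s => μ s X Y) p) (X Y : Vec n) :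
    ContDiffAt ℝ k (fun s => piAct (P s) (μ s) X Y) p :=
  ((contDiffAt_mulVec hP (hμ X Y)).sub
    (contDiffAt_bracket hμ (contDiffAt_mulVec hP contDiffAt_const) contDiffAt_const)).sub
    (contDiffAt_bracket hμ contDiffAt_const (contDiffAt_mulVec hP contDiffAt_const))

end Smoothness

/-! ### Uniqueness for the bracket flow and the pluriclosed flow -/

section FlowUniqueness

variable {n : ℕ} {J : Matrix (Fin n) (Fin n) ℝ}

/-- The bracket with structure constants `c`. -/
def bracketOfCoeffs (c : Fin n → Fin n → Vec n) : Bracket n :=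
  LinearMap.mk₂ ℝ (fun X Y => ∑ i, ∑ j, (X i * Y j) • c i j)
    (by intro X X' Y; simp only [Pi.add_apply, add_mul, add_smul, Finset.sum_add_distrib])
    (by intro r X Y; simp only [Pi.smul_apply, smul_eq_mul, Finset.smul_sum, smul_smul, mul_assoc])
    (by intro X Y Y'; simp only [Pi.add_apply, mul_add, add_smul, Finset.sum_add_distrib])
    (by intro r X Y; simp only [Pi.smul_apply, smul_eq_mul, Finset.smul_sum, smul_smul,
          mul_left_comm])

theorem bracketOfCoeffs_apply (c : Fin n → Fin n → Vec n) (X Y : Vec n) :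
    bracketOfCoeffs c X Y = ∑ i, ∑ j, (X i * Y j) • c i j := rfl

theorem bracketOfCoeffs_coeffs (μ : Bracket n) :
    bracketOfCoeffs (fun i j => μ (stdVec i) (stdVec j)) = μ := by
  refine LinearMap.ext fun X => LinearMap.ext fun Y => ?_
  conv_rhs => rw [← sum_smul_stdVec X, ← sum_smul_stdVec Y]
  simp only [bracketOfCoeffs_apply, map_sum, map_smul, LinearMap.sum_apply, LinearMap.smul_apply,
    Finset.smul_sum, smul_smul]
  rw [Finset.sum_comm]
  exact Finset.sum_congr rfl fun j _ => Finset.sum_congr rfl fun i _ => by rw [mul_comm]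

theorem contDiff_bracketOfCoeffs {k : WithTop ℕ∞} (X Y : Vec n) :
    ContDiff ℝ k (fun c => bracketOfCoeffs c X Y) := by
  simp only [bracketOfCoeffs_apply]
  fun_prop

/-- Structure constants move the equation to a normed space. As g₀ is fixed and invertible, the
field is C¹ everywhere. -/
theorem IsBracketFlow.eqOn_Ico {g₀ : Matrix (Fin n) (Fin n) ℝ} (hdet : g₀.det ≠ 0) {T : ℝ}
    {μ ν : ℝ → Bracket n} (hμ : IsBracketFlow J g₀ μ (Set.Ico 0 T))
    (hν : IsBracketFlow J g₀ ν (Set.Ico 0 T)) (h0 : μ 0 = ν 0) : Set.EqOn μ ν (Set.Ico 0 T) := by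
  have key := eqOn_Ico_of_contDiffAt (T := T)
    (v := fun c i j => -piAct (bracketP J g₀ (bracketOfCoeffs c)) (bracketOfCoeffs c)
      (stdVec i) (stdVec j))
    (f := fun t i j => μ t (stdVec i) (stdVec j)) (g := fun t i j => ν t (stdVec i) (stdVec j))
    (fun t _ => contDiffAt_pi.2 fun i => contDiffAt_pi.2 fun j =>
      have h := fun X Y => (contDiff_bracketOfCoeffs (k := 1) X Y).contDiffAt
      (contDiffAt_piAct (contDiffAt_bracketP h hdet) h _ _).neg)
    (fun t ht => hasDerivWithinAt_pi.2 fun i => hasDerivWithinAt_pi.2 fun j => by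
      simpa only [bracketOfCoeffs_coeffs] using hμ t ht (stdVec i) (stdVec j))
    (fun t ht => hasDerivWithinAt_pi.2 fun i => hasDerivWithinAt_pi.2 fun j => by
      simpa only [bracketOfCoeffs_coeffs] using hν t ht (stdVec i) (stdVec j))
    (by simp only [h0])
  intro t ht
  rw [← bracketOfCoeffs_coeffs (μ t), ← bracketOfCoeffs_coeffs (ν t)]
  exact congrArg bracketOfCoeffs (key ht)

/-- Recovers g from ω, turning the evolution of forms into an ODE for the Gram matrix. -/
theorem fundForm_neg_mulVec_stdVec (hJ : J * J = -1) (g : Matrix (Fin n) (Fin n) ℝ)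
    (i j : Fin n) : fundForm J g (-(J *ᵥ stdVec i)) (stdVec j) = g i j := by
  rw [fundForm, Matrix.mulVec_neg, Matrix.mulVec_mulVec, hJ, Matrix.neg_mulVec, Matrix.one_mulVec,
    neg_neg]
  simp [inner, stdVec]

/-- The field is C¹ wherever the Gram matrix is invertible, which positive definiteness ensures
along `h`. -/
theorem IsPluriclosedFlow.eqOn_Ico {μ : Bracket n} {T : ℝ}
    {g h : ℝ → Matrix (Fin n) (Fin n) ℝ} (hg : IsPluriclosedFlow μ J g (Set.Ico 0 T))
    (hh : IsPluriclosedFlow μ J h (Set.Ico 0 T)) (h0 : g 0 = h 0) :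
    Set.EqOn g h (Set.Ico 0 T) := by
  refine eqOn_Ico_of_contDiffAt (E := Fin n → Fin n → ℝ) (T := T)
    (v := fun c i j => -bismutRicci11 μ J (Matrix.of c) (-(J *ᵥ stdVec i)) (stdVec j))
    (f := g) (g := h) (fun t ht => ?_) (fun t ht => ?_) (fun t ht => ?_) h0
  · exact contDiffAt_pi.2 fun i => contDiffAt_pi.2 fun j =>
      (contDiffAt_bismutRicci11 (fun _ _ => contDiffAt_const)
        (fun a b => (contDiff_apply_apply ℝ ℝ a b).contDiffAt)
        (hh t ht).1.posDef.det_pos.ne' _ _).neg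
  · refine hasDerivWithinAt_pi.2 fun i => hasDerivWithinAt_pi.2 fun j => ?_
    have h := (hg t ht).2 (-(J *ᵥ stdVec i)) (stdVec j)
    simp only [fundForm_neg_mulVec_stdVec (hg t ht).1.sq] at h
    exact h
  · refine hasDerivWithinAt_pi.2 fun i => hasDerivWithinAt_pi.2 fun j => ?_
    have h := (hh t ht).2 (-(J *ᵥ stdVec i)) (stdVec j)
    simp only [fundForm_neg_mulVec_stdVec (hh t ht).1.sq] at h
    exact h

end FlowUniqueness


/-! ### Normal form of the seven families -/

theorem halfRank_rotBlocks (x b y c : ℝ) :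
    halfRank (rotBlocks x b y c) = (if x = 0 then 0 else 1) + (if y = 0 then 0 else 1) := by
  have h : rotBlocks x b y c + (rotBlocks x b y c)ᵀ =
      Matrix.diagonal ![x + x, x + x, y + y, y + y] := by
    ext i j
    fin_cases i <;> fin_cases j <;> simp [rotBlocks]
  rw [halfRank, h, Matrix.rank_diagonal, Fintype.card_subtype, Finset.card_filter]
  simp only [Fin.sum_univ_four, Matrix.cons_val]
  by_cases hx : x = 0 <;> by_cases hy : y = 0 <;> norm_num [hx, hy]

/-- The data are of the form `rotBlocks x b y c`, with diagonal entries satisfying the pluriclosed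
condition, and the coefficient in `scaling` is `a² - a x - a y`. -/
theorem SplitGKData.exists_rotBlocks {a : ℝ} {A : Matrix (Fin 4) (Fin 4) ℝ}
    (h : SplitGKData a A) : a ≠ 0 ∧ ∃ x b y c, A = rotBlocks x b y c ∧
      x * (a + 2 * x) = 0 ∧ y * (a + 2 * y) = 0 ∧
      a ^ 2 * (halfRank A / 2 + 1) = a ^ 2 - a * x - a * y := by
  cases h with
  | k1 =>
    refine ⟨one_ne_zero, -1 / 2, 0, -1 / 2, 0, ?_⟩
    have hA : !![-1/2, 0, 0, 0; 0, -1/2, 0, 0; 0, 0, -1/2, 0; 0, 0, 0, -1/2] =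
        rotBlocks (-1 / 2) 0 (-1 / 2) 0 := by simp [rotBlocks]
    rw [hA, halfRank_rotBlocks]
    norm_num
  | k17 =>
    refine ⟨one_ne_zero, -1 / 2, 0, 0, 0, ?_⟩
    have hA : !![-1/2, 0, 0, 0; 0, -1/2, 0, 0; 0, 0, 0, 0; 0, 0, 0, 0] =
        rotBlocks (-1 / 2) 0 0 0 := by simp [rotBlocks]
    rw [hA, halfRank_rotBlocks]
    norm_num
  | k8_zero p hp =>
    refine ⟨hp, -a / 2, 0, 0, 1, ?_⟩
    have hA : !![-a/2, 0, 0, 0; 0, -a/2, 0, 0; 0, 0, 0, 1; 0, 0, -1, 0] =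
        rotBlocks (-a / 2) 0 0 1 := by simp [rotBlocks]
    rw [hA, halfRank_rotBlocks]
    refine ⟨rfl, by ring, by ring, ?_⟩
    simp [hp]
    ring
  | k8_half p hp =>
    refine ⟨hp, -a / 2, 0, -a / 2, 1, ?_⟩
    have hA : !![-a/2, 0, 0, 0; 0, -a/2, 0, 0; 0, 0, -a/2, 1; 0, 0, -1, -a/2] =
        rotBlocks (-a / 2) 0 (-a / 2) 1 := by simp [rotBlocks]
    rw [hA, halfRank_rotBlocks]
    refine ⟨rfl, by ring, by ring, ?_⟩
    simp [hp]
    ring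
  | k11_zero p s hp hs hs' =>
    refine ⟨hp, -a / 2, 1, 0, s, ?_⟩
    change rotBlocks (-a / 2) 1 0 s = _ ∧ _ ∧ _ ∧
      a ^ 2 * (halfRank (rotBlocks (-a / 2) 1 0 s) / 2 + 1) = _
    rw [halfRank_rotBlocks]
    refine ⟨rfl, by ring, by ring, ?_⟩
    simp [hp]
    ring
  | k11_half p s hp hs hs' =>
    refine ⟨hp, -a / 2, 1, -a / 2, s, ?_⟩
    change rotBlocks (-a / 2) 1 (-a / 2) s = _ ∧ _ ∧ _ ∧
      a ^ 2 * (halfRank (rotBlocks (-a / 2) 1 (-a / 2) s) / 2 + 1) = _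
    rw [halfRank_rotBlocks]
    refine ⟨rfl, by ring, by ring, ?_⟩
    simp [hp]
    ring
  | k19 p hp =>
    refine ⟨hp, -a / 2, 1, 0, 0, ?_⟩
    have hA : !![-a/2, 1, 0, 0; -1, -a/2, 0, 0; 0, 0, 0, 0; 0, 0, 0, 0] =
        rotBlocks (-a / 2) 1 0 0 := by simp [rotBlocks]
    rw [hA, halfRank_rotBlocks]
    refine ⟨rfl, by ring, by ring, ?_⟩
    simp [hp]
    ring

/-! ### Explicit solutions of the two flows -/

theorem stretchedMetric_one : stretchedMetric 1 = stdMetric := by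
  rw [stretchedMetric, stdMetric, ← Matrix.diagonal_one]
  congr 1
  ext i
  fin_cases i <;> rfl

theorem smul_rotBlocks (r x b y c : ℝ) :
    r • rotBlocks x b y c = rotBlocks (r * x) (r * b) (r * y) (r * c) := by
  simp [rotBlocks]

theorem bracketP_almostAbelian (a x b y c : ℝ) :
    bracketP Jplus stdMetric (almostAbelian a 0 (rotBlocks x b y c)) =
      (-(a ^ 2 - a * x - a * y) / 2) • Matrix.diagonal ![1, 0, 0, 0, 0, 1] := by
  -- The transpose represents X ↦ ω₀(X, ·), which for g₀ = 1 is J₊ itself.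
  have hω : (formMatrix (fundForm Jplus stdMetric))ᵀ = Jplus := by
    ext i j
    simp only [formMatrix, fundForm, ← stretchedMetric_one, inner_stretchedMetric, Jplus_mulVec]
    fin_cases i <;> fin_cases j <;> simp [Jplus, stdVec]
  have hinv : Jplus⁻¹ = -Jplus := Matrix.inv_eq_right_inv (by
    rw [mul_neg, (isHermitianStructure_Jplus 0 0 0 0 0 one_pos).sq, neg_neg])
  rw [bracketP, hω, hinv]
  ext i j
  simp only [← stretchedMetric_one, formMatrix,
    bismutRicci11_stretchedMetric _ _ _ _ _ one_ne_zero, Matrix.smul_apply, Matrix.mul_apply,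
    Matrix.transpose_apply, Matrix.of_apply, Fin.sum_univ_six, stdVec]
  fin_cases i <;> fin_cases j <;> simp [Jplus] <;> ring

/-- P is -K/2 times the projection D onto ⟨f₁, f₆⟩, and π(D)μ = -μ: on [f₆, f₁] the weights give 1 -
1 - 1, on [f₆, fᵢ] with 2 ≤ i ≤ 5 they give 0 - 1 - 0. -/
theorem piAct_bracketP_almostAbelian (a x b y c : ℝ) (X Y : Vec 6) :
    piAct (bracketP Jplus stdMetric (almostAbelian a 0 (rotBlocks x b y c)))
      (almostAbelian a 0 (rotBlocks x b y c)) X Y =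
      ((a ^ 2 - a * x - a * y) / 2) • almostAbelian a 0 (rotBlocks x b y c) X Y := by
  rw [bracketP_almostAbelian]
  ext i
  simp only [piAct, almostAbelian_rotBlocks, Matrix.smul_mulVec, Matrix.mulVec_diagonal,
    Pi.sub_apply, Pi.smul_apply]
  fin_cases i <;> simp <;> ring

section Scaling

variable {K t : ℝ}

theorem hasDerivAt_one_div_sqrt (h : 0 < 1 + K * t) :
    HasDerivAt (fun s => 1 / √(1 + K * s)) (-(K / 2) * (1 / √(1 + K * t)) ^ 3) t := by
  have h1 : HasDerivAt (fun s => 1 + K * s) K t := by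
    simpa using ((hasDerivAt_id t).const_mul K).const_add 1
  have hs : √(1 + K * t) ≠ 0 := (Real.sqrt_pos.2 h).ne'
  simp only [one_div]
  refine ((h1.sqrt h.ne').fun_inv hs).congr_deriv ?_
  field_simp

theorem inv_one_div_sqrt_sq (h : 0 ≤ 1 + K * t) : (1 / √(1 + K * t))⁻¹ ^ 2 = 1 + K * t := by
  rw [one_div, inv_inv, Real.sq_sqrt h]

end Scaling

variable {a x b y c : ℝ}

theorem isBracketFlow_almostAbelian (hK : 0 ≤ a ^ 2 - a * x - a * y) :
    IsBracketFlow Jplus stdMetric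
      (fun t => almostAbelian (1 / √(1 + (a ^ 2 - a * x - a * y) * t) * a) 0
        ((1 / √(1 + (a ^ 2 - a * x - a * y) * t)) • rotBlocks x b y c)) (Set.Ici 0) := by
  intro t ht X Y
  have hsmul : ∀ r : ℝ, almostAbelian (r * a) 0 (r • rotBlocks x b y c) X Y =
      r • almostAbelian a 0 (rotBlocks x b y c) X Y := by
    intro r
    ext i
    rw [smul_rotBlocks]
    fin_cases i <;> simp [almostAbelian_rotBlocks] <;> ring
  have hd := hasDerivAt_one_div_sqrt (K := a ^ 2 - a * x - a * y) (t := t)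
    (by have := mul_nonneg hK ht; linarith)
  have hfun := (hd.smul_const (almostAbelian a 0 (rotBlocks x b y c) X Y)).hasDerivWithinAt
    (s := Set.Ici 0)
  simp only [hsmul]
  refine hfun.congr_deriv ?_
  -- Scaling the data by r multiplies K by r², so the field scales by r³, matching c' = -(K/2)c³.
  rw [smul_rotBlocks, piAct_bracketP_almostAbelian, ← smul_rotBlocks, hsmul, smul_smul, ← neg_smul]
  congr 1
  ring

theorem isPluriclosedFlow_stretchedMetric (hK : 0 ≤ a ^ 2 - a * x - a * y) :
    IsPluriclosedFlow (almostAbelian a 0 (rotBlocks x b y c)) Jplus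
      (fun t => stretchedMetric (1 + (a ^ 2 - a * x - a * y) * t)) (Set.Ici 0) := by
  intro t ht
  have hpos : 0 < 1 + (a ^ 2 - a * x - a * y) * t := by
    have := mul_nonneg hK ht
    linarith
  refine ⟨isHermitianStructure_Jplus a x b y c hpos, fun X Y => ?_⟩
  rw [bismutRicci11_stretchedMetric _ _ _ _ _ hpos.ne']
  simp only [fundForm, inner_stretchedMetric]
  have h1 : HasDerivWithinAt (fun s => 1 + (a ^ 2 - a * x - a * y) * s) (a ^ 2 - a * x - a * y)
      (Set.Ici 0) t := by
    simpa using (((hasDerivAt_id t).const_mul _).const_add 1).hasDerivWithinAt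
  refine (((((h1.mul_const _).add_const _).add_const _).add_const _).add_const _).congr_deriv ?_
  simp only [Jplus_mulVec, Matrix.cons_val]
  ring

/-! ### Automorphisms and the soliton -/

/-- The automorphism `diag(1, r, r, r, r, 1)` of `𝔤(a, 0, A)`. -/
def idealDilation (r : ℝ) : Matrix (Fin 6) (Fin 6) ℝ := Matrix.diagonal ![1, r, r, r, r, 1]

theorem idealDilation_mulVec (r : ℝ) (X : Vec 6) :
    idealDilation r *ᵥ X = ![X 0, r * X 1, r * X 2, r * X 3, r * X 4, X 5] := by
  ext i
  rw [idealDilation, Matrix.mulVec_diagonal]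
  fin_cases i <;> simp

theorem isLieAutomorphism_idealDilation {r : ℝ} (hr : r ≠ 0) :
    IsLieAutomorphism (almostAbelian a 0 (rotBlocks x b y c)) (idealDilation r) := by
  refine ⟨?_, fun X Y => ?_⟩
  · rw [idealDilation, Matrix.det_diagonal, isUnit_iff_ne_zero]
    simp [Fin.prod_univ_six, hr]
  · ext i
    simp only [idealDilation_mulVec, almostAbelian_rotBlocks]
    fin_cases i <;> simp <;> ring

theorem idealDilation_mul_Jplus (r : ℝ) : idealDilation r * Jplus = Jplus * idealDilation r := by
  ext i j
  rw [idealDilation, Matrix.diagonal_mul, Matrix.mul_diagonal]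
  fin_cases i <;> fin_cases j <;> simp [Jplus]

theorem idealDilation_mul_Jminus (r : ℝ) :
    idealDilation r * Jminus = Jminus * idealDilation r := by
  ext i j
  rw [idealDilation, Matrix.diagonal_mul, Matrix.mul_diagonal]
  fin_cases i <;> fin_cases j <;> simp [Jminus]

theorem contDiffOn_idealDilation {r : ℝ → ℝ} {s : Set ℝ} {k : WithTop ℕ∞} (hr : ContDiffOn ℝ k r s)
    (i j : Fin 6) : ContDiffOn ℝ k (fun t => idealDilation (r t) i j) s := by
  simp only [idealDilation, Matrix.diagonal_apply]
  by_cases h : i = j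
  · simp only [h, if_true]
    fin_cases j <;> simp [hr, contDiffOn_const]
  · simp only [h, if_false, contDiffOn_const]

theorem isGKSoliton_almostAbelian (hx : x * (a + 2 * x) = 0) (hy : y * (a + 2 * y) = 0)
    (hK : 0 ≤ a ^ 2 - a * x - a * y) :
    IsGKSoliton (almostAbelian a 0 (rotBlocks x b y c)) Jplus Jminus stdMetric
      (fun t => (1 / √(1 + (a ^ 2 - a * x - a * y) * t))⁻¹ ^ 2) := by
  have hpos : ∀ t ∈ Set.Ici (0 : ℝ), 0 < 1 + (a ^ 2 - a * x - a * y) * t := fun t ht => by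
    have := mul_nonneg hK ht
    linarith
  have hflow := isPluriclosedFlow_stretchedMetric (b := b) (c := c) hK
  have h0 : stretchedMetric (1 + (a ^ 2 - a * x - a * y) * 0) = stdMetric := by
    rw [mul_zero, add_zero, stretchedMetric_one]
  refine ⟨fun t => stretchedMetric (1 + (a ^ 2 - a * x - a * y) * t), h0,
    ⟨hflow, fun t ht => isSplitGK_stretchedMetric hx hy (hpos t ht)⟩, fun T g' hg' hg'0 => ?_,
    fun t => idealDilation (1 / √(1 + (a ^ 2 - a * x - a * y) * t)), ?_, ?_, fun t ht => ?_⟩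
  · refine hg'.eqOn_Ico (fun t ht => ?_) (hg'0.trans h0.symm)
    obtain ⟨hherm, hd⟩ := hflow t ht.1
    exact ⟨hherm, fun X Y => (hd X Y).mono fun s hs => hs.1⟩
  · ext i j
    fin_cases i <;> fin_cases j <;> simp [idealDilation]
  · refine contDiffOn_idealDilation (contDiffOn_const.div (ContDiffOn.sqrt ?_ fun t ht => ?_)
      fun t ht => ?_)
    · fun_prop
    · exact (hpos t ht).ne'
    · exact (Real.sqrt_pos.2 (hpos t ht)).ne'
  · have hp := hpos t ht
    refine ⟨isLieAutomorphism_idealDilation (one_div_pos.2 (Real.sqrt_pos.2 hp)).ne',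
      idealDilation_mul_Jplus _, idealDilation_mul_Jminus _, ?_, fun X Y => ?_⟩
    · dsimp only
      rwa [inv_one_div_sqrt_sq hp.le]
    · dsimp only
      rw [inv_one_div_sqrt_sq hp.le, ← stretchedMetric_one]
      simp only [inner_stretchedMetric, idealDilation_mulVec, Matrix.cons_val]
      -- With r = u^{-1/2}, u r² = 1 leaves the coefficients on f₂, …, f₅ equal to 1.
      have hr : (1 + (a ^ 2 - a * x - a * y) * t) *
          (1 / √(1 + (a ^ 2 - a * x - a * y) * t)) ^ 2 = 1 := by
        rw [div_pow, Real.sq_sqrt hp.le, one_pow, mul_one_div_cancel hp.ne']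
      linear_combination -(X 1 * Y 1 + X 2 * Y 2 + X 3 * Y 3 + X 4 * Y 4) * hr

end LieGK
end

theorem mainTheorem7 (a₀ : ℝ) (A₀ : Matrix (Fin 4) (Fin 4) ℝ) (h : LieGK.SplitGKData a₀ A₀) :
    LieGK.IsSplitGK (LieGK.almostAbelian a₀ 0 A₀) LieGK.Jplus LieGK.Jminus LieGK.stdMetric ∧
    LieGK.IsBracketFlow LieGK.Jplus LieGK.stdMetric
      (fun t => LieGK.almostAbelian (LieGK.scaling a₀ A₀ t * a₀) 0 (LieGK.scaling a₀ A₀ t • A₀))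
      (Set.Ici 0) ∧
    (∀ (T : ℝ) (μ : ℝ → LieGK.Bracket 6),
      LieGK.IsBracketFlow LieGK.Jplus LieGK.stdMetric μ (Set.Ico 0 T) →
      μ 0 = LieGK.almostAbelian a₀ 0 A₀ →
      ∀ t ∈ Set.Ico 0 T, μ t =
        LieGK.almostAbelian (LieGK.scaling a₀ A₀ t * a₀) 0 (LieGK.scaling a₀ A₀ t • A₀)) ∧
    LieGK.IsGKSoliton (LieGK.almostAbelian a₀ 0 A₀) LieGK.Jplus LieGK.Jminus LieGK.stdMetric
      (fun t => (LieGK.scaling a₀ A₀ t)⁻¹ ^ 2) ∧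
    LieGK.IsExpandingGKSoliton (LieGK.almostAbelian a₀ 0 A₀) LieGK.Jplus LieGK.Jminus
      LieGK.stdMetric := by
  obtain ⟨ha, x, b, y, c, hA, hx, hy, hK⟩ := h.exists_rotBlocks
  have hKpos : 0 < a₀ ^ 2 - a₀ * x - a₀ * y := by
    -- The pluriclosed conditions give -ax = 2x² and -ay = 2y², so K = a² + 2x² + 2y² > 0.
    have := pow_pos (abs_pos.2 ha) 2
    rw [sq_abs] at this
    nlinarith [sq_nonneg x, sq_nonneg y]
  have hscal : LieGK.scaling a₀ A₀ = fun t => 1 / √(1 + (a₀ ^ 2 - a₀ * x - a₀ * y) * t) := by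
    funext t
    rw [LieGK.scaling, hK]
  subst hA
  rw [hscal]
  have hbf := LieGK.isBracketFlow_almostAbelian (b := b) (c := c) hKpos.le
  have hsol := LieGK.isGKSoliton_almostAbelian (b := b) (c := c) hx hy hKpos.le
  refine ⟨?_, hbf, fun T μ hμ hμ0 => ?_, hsol, _, hsol, fun s hs t ht hst => ?_⟩
  · rw [← LieGK.stretchedMetric_one]
    exact LieGK.isSplitGK_stretchedMetric hx hy one_pos
  · refine hμ.eqOn_Ico (by simp [LieGK.stdMetric])
      (fun t ht X Y => (hbf t ht.1 X Y).mono fun s hs => hs.1) ?_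
    simpa using hμ0
  · have hs' := mul_nonneg hKpos.le hs
    have ht' := mul_nonneg hKpos.le ht
    -- The scaling factor c⁻² is the affine function 1 + Kt of positive slope.
    rw [LieGK.inv_one_div_sqrt_sq (by linarith), LieGK.inv_one_div_sqrt_sq (by linarith)]
    linarith [mul_lt_mul_of_pos_left hst hKpos]
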